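/- Let $\mathcal M$ be a von Neumann algebra (on a complex Hilbert space) without central summands of type $I_1$; that is, there is no nonzero central projection $C\in\mathcal M$ such that $C\mathcal M$ is commutative. Let $\mathcal Z(\mathcal M)$ be the center of $\mathcal M$, write $[A,B]=AB-BA$, and let $L:\mathcal M\to\mathcal M$ be an additive map. Then $L$ is a Lie derivation, i.e. $L([A,B])=[L(A),B]+[A,L(B)]$ for all $A,B\in\mathcal M$, if and only if there exist an additive derivation $\varphi:\mathcal M\to\mathcal M$ (an additive map with $\varphi(AB)=\varphi(A)B+A\varphi(B)$ for all $A,B\in\mathcal M$) and an additive map $f:\mathcal M\to\mathcal Z(\mathcal M)$ with $f([A,B])=0$ for all $A,B\in\mathcal M$ such that $L=\varphi+f$. -/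

import Mathlib

/-- An additive map `d` of an associative ring is an (additive) derivation if
`d (A B) = d A B + A d B` for all `A`, `B`. -/
def IsAdditiveDerivation {R : Type*} [Ring R] (d : R →+ R) : Prop :=
  ∀ A B : R, d (A * B) = d A * B + A * d B

/-- An additive map `L` of an associative ring is an (additive) Lie derivation if
`L [A, B] = [L A, B] + [A, L B]` for all `A`, `B`, where `⁅A, B⁆ = A * B - B * A`. -/
def IsAdditiveLieDerivation {R : Type*} [Ring R] (L : R →+ R) : Prop :=
  ∀ A B : R, L ⁅A, B⁆ = ⁅L A, B⁆ + ⁅A, L B⁆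

namespace VonNeumannAlgebra

variable {H : Type*} [NormedAddCommGroup H] [InnerProductSpace ℂ H] [CompleteSpace H]

/-- `C` is a central projection of `M`. -/
def IsCentralProjection (M : VonNeumannAlgebra H) (C : M) : Prop :=
  IsStarProjection C ∧ C ∈ Subring.center M

/-- `E` is an abelian projection of `M`: a projection such that the corner `E M E` is
commutative. -/
def IsAbelianProjection (M : VonNeumannAlgebra H) (E : M) : Prop :=
  IsStarProjection E ∧ ∀ A B : M, Commute (E * A * E) (E * B * E)

/-- `M` has no central summand of type `I₁`: a central summand is `C M` for a nonzero central
projection `C`, and it is of type `I₁` when its unit `C` is an abelian projection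
(equivalently, when `C M` is commutative). -/
def HasNoCentralSummandTypeI₁ (M : VonNeumannAlgebra H) : Prop :=
  ∀ C : M, M.IsCentralProjection C → M.IsAbelianProjection C → C = 0

end VonNeumannAlgebra

/-! The substance is the forward direction, and it is ring theory over a Peirce decomposition. Given
a faithful pair `e`, `f`, an inner derivation is subtracted so that `L e` becomes central. Then `L`
preserves both off-diagonal corners. On a diagonal corner, the component of `L a` in the opposite
corner is central there, hence the compression of a central element of the ring. Removing these
elements from `L` leaves a map `φ` that preserves all four corners and is a Lie derivation up to a
central map `g`.

Leibniz for `φ` is immediate when a bracket reduces to one product. It passes to products inside a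
diagonal corner because that corner acts faithfully on the off-diagonal one. For opposite
off-diagonal `x`, `y` the defect is governed by `z = g (x * y - y * x)`. Expanding `φ (x * y * x)`
in two ways gives `z * x = 0`, and polarisation gives `z * z = 0`; the centre is reduced, so `z = 0`
(`IsPeirceLieDerivation.defect_eq_zero`).

Operator theory supplies the pair. A maximal set of square-zero elements generating mutually
annihilating ideals has a left annihilator whose projections are central, and absence of type I₁
summands makes that annihilator zero. The projection onto the closed span of the ranges of the set
is `e` (`HasNoCentralSummandTypeI₁.exists_projection`). Centres of corners are lifted one projection
at a time, through central supports, and then along a norm-convergent expansion of self-adjoint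
elements into spectral projections (`exists_central_of_corner`). -/

/-! ### Faithful pairs of idempotents -/

/-- Complementary idempotents `e`, `f` of a ring, each of them faithful, such that the centres of
the two corners are the compressions of the centre of the ring. -/
structure IsFaithfulPair {R : Type*} [Ring R] (e f : R) : Prop where
  idem : e * e = e
  add_eq_one : e + f = 1
  eq_zero_of_mul_left : ∀ a : R, (∀ r, a * r * e = 0) → a = 0
  eq_zero_of_mul_left' : ∀ a : R, (∀ r, a * r * f = 0) → a = 0
  eq_zero_of_mul_right : ∀ a : R, (∀ r, e * r * a = 0) → a = 0
  eq_zero_of_mul_right' : ∀ a : R, (∀ r, f * r * a = 0) → a = 0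
  exists_center : ∀ c : R, e * c = c → c * e = c →
    (∀ a, e * a = a → a * e = a → c * a = a * c) → ∃ z ∈ Subring.center R, c = z * e
  exists_center' : ∀ c : R, f * c = c → c * f = c →
    (∀ a, f * a = a → a * f = a → c * a = a * c) → ∃ z ∈ Subring.center R, c = z * f

namespace IsFaithfulPair

variable {R : Type*} [Ring R] {e f : R}

theorem eq_sub (h : IsFaithfulPair e f) : f = 1 - e := by
  rw [← h.add_eq_one]; abel

theorem symm (h : IsFaithfulPair e f) : IsFaithfulPair f e where
  idem := by rw [h.eq_sub]; linear_combination (norm := noncomm_ring) h.idem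
  add_eq_one := by rw [add_comm, h.add_eq_one]
  eq_zero_of_mul_left := h.eq_zero_of_mul_left'
  eq_zero_of_mul_left' := h.eq_zero_of_mul_left
  eq_zero_of_mul_right := h.eq_zero_of_mul_right'
  eq_zero_of_mul_right' := h.eq_zero_of_mul_right
  exists_center := h.exists_center'
  exists_center' := h.exists_center

theorem mul_eq_zero (h : IsFaithfulPair e f) : e * f = 0 := by
  rw [h.eq_sub, mul_sub, h.idem, mul_one, sub_self]

theorem left_mul_eq_zero (h : IsFaithfulPair e f) {x : R} (hx : e * x = x) : f * x = 0 := by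
  rw [← hx, ← mul_assoc, h.symm.mul_eq_zero, zero_mul]

theorem mul_right_eq_zero (h : IsFaithfulPair e f) {x : R} (hx : x * e = x) : x * f = 0 := by
  rw [← hx, mul_assoc, h.mul_eq_zero, mul_zero]

theorem left_mul_eq_self (h : IsFaithfulPair e f) {x : R} (hx : f * x = 0) : e * x = x := by
  rw [h.symm.eq_sub, sub_mul, hx, one_mul, sub_zero]

theorem mul_right_eq_self (h : IsFaithfulPair e f) {x : R} (hx : x * f = 0) : x * e = x := by
  rw [h.symm.eq_sub, mul_sub, hx, mul_one, sub_zero]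

theorem mul_eq_zero_of_left_of_right (h : IsFaithfulPair e f) {x y : R} (hx : x * e = x)
    (hy : f * y = y) : x * y = 0 := by
  rw [← hx, mul_assoc, h.symm.left_mul_eq_zero hy, mul_zero]

/-- Elements are determined by their action on the off-diagonal corner. -/
theorem eq_zero_of_forall_mul (h : IsFaithfulPair e f) {a : R} (ha : a * e = a)
    (hax : ∀ x, e * x = x → x * f = x → a * x = 0) : a = 0 := by
  refine h.eq_zero_of_mul_left' a fun r => ?_
  have := hax (e * r * f) (by simp only [← mul_assoc, h.idem])
    (by simp only [mul_assoc, h.symm.idem])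
  rwa [← mul_assoc, ← mul_assoc, ha] at this

theorem eq_zero_of_center (h : IsFaithfulPair e f) {z : R} (hz : z ∈ Subring.center R)
    (hze : z * e = 0) : z = 0 := by
  refine h.eq_zero_of_mul_left z fun r => ?_
  rw [← Subring.mem_center_iff.1 hz r, mul_assoc, hze, mul_zero]

/-- A central element annihilating the off-diagonal corner vanishes. -/
theorem eq_zero_of_center_of_forall_mul (h : IsFaithfulPair e f) {z : R}
    (hz : z ∈ Subring.center R) (hzx : ∀ x, e * x = x → x * f = x → z * x = 0) : z = 0 := by
  refine h.eq_zero_of_center hz (h.eq_zero_of_forall_mul (by rw [mul_assoc, h.idem]) ?_)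
  intro x hx hx'
  rw [mul_assoc, hx, hzx x hx hx']

end IsFaithfulPair

/-! ### Lie derivations with central value at `e` -/

namespace IsAdditiveLieDerivation

variable {R : Type*} [Ring R] {e f : R} {L : R →+ R}

theorem map_one_mem_center (hL : IsAdditiveLieDerivation L) : L 1 ∈ Subring.center R := by
  rw [Subring.mem_center_iff]
  intro g
  have := hL 1 g
  simp only [Ring.lie_def, one_mul, mul_one, sub_self, map_zero, add_zero] at this
  exact (sub_eq_zero.1 (by simpa using this.symm)).symm

/-- A Lie derivation with central value at `e` preserves the off-diagonal corners. -/
theorem map_offDiagonal (hL : IsAdditiveLieDerivation L) (h : IsFaithfulPair e f)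
    (htwo : ∀ a : R, a + a = 0 → a = 0) (hLe : L e ∈ Subring.center R) {x : R}
    (hx : e * x = x) (hx' : x * f = x) : e * L x = L x ∧ L x * f = L x := by
  have hxe : x * e = 0 := h.symm.mul_right_eq_zero hx'
  have key : L x = e * L x - L x * e := by
    have := hL e x
    simp only [Ring.lie_def, hx, hxe, sub_zero, Subring.mem_center_iff.1 hLe x, sub_self,
      zero_add] at this
    exact this
  -- Compressing `key` by `f` and `e` gives `f * L x * e = -(f * L x * e)`.
  have h1 : f * L x * e = 0 := by
    apply htwo
    linear_combination (norm := noncomm_ring) f * key * e + h.symm.mul_eq_zero * L x * e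
      - f * L x * h.idem
  have h2 : f * L x = 0 := by
    linear_combination (norm := noncomm_ring) f * key + h.symm.mul_eq_zero * L x - h1
  have h3 := h.left_mul_eq_self h2
  refine ⟨h3, h.symm.mul_right_eq_self ?_⟩
  linear_combination (norm := noncomm_ring) h3 + key

theorem map_diagonal (hL : IsAdditiveLieDerivation L) (hLe : L e ∈ Subring.center R) {a : R}
    (ha : e * a = a) (ha' : a * e = a) : e * L a = L a * e := by
  have := hL e a
  simp only [Ring.lie_def, ha, ha', sub_self, map_zero, Subring.mem_center_iff.1 hLe a,
    zero_add] at this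
  exact sub_eq_zero.1 this.symm

/-- The opposite diagonal component of the value on a corner comes from the centre. -/
theorem exists_center_of_diagonal (hL : IsAdditiveLieDerivation L) (h : IsFaithfulPair e f)
    (hLe : L e ∈ Subring.center R) (hLf : L f ∈ Subring.center R) {a : R}
    (ha : e * a = a) (ha' : a * e = a) :
    ∃ z ∈ Subring.center R, L a * f = z * f := by
  have hfc : f * L a = L a * f := by
    have := hL.map_diagonal hLe ha ha'
    rw [h.eq_sub]
    linear_combination (norm := noncomm_ring) -this
  refine h.exists_center' _ (by rw [← mul_assoc, hfc, mul_assoc, h.symm.idem])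
    (by rw [mul_assoc, h.symm.idem]) fun b hb hb' => ?_
  have hab : a * b = 0 := h.mul_eq_zero_of_left_of_right ha' hb
  have hba : b * a = 0 := h.symm.mul_eq_zero_of_left_of_right hb' ha
  have hb2 := hL.map_diagonal hLf hb hb'
  have := hL a b
  simp only [Ring.lie_def, hab, hba, sub_self, map_zero] at this
  have hfa := h.left_mul_eq_zero ha
  have haf := h.mul_right_eq_zero ha'
  -- `L b` commutes with `f`, so `[a, L b]` has no component in the `f` corner; since `[a, b] = 0`,
  -- neither has `[L a, b]`.
  have h3 : (a * L b - L b * a) * f = 0 := by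
    linear_combination (norm := noncomm_ring) -a * hb2 - L b * haf + haf * L b
  have e1 : L a * b * f = L a * f * b := by rw [mul_assoc, hb', mul_assoc, hb]
  have e2 : b * L a * f = b * (L a * f) := by rw [mul_assoc]
  linear_combination (norm := noncomm_ring) -this * f - h3 - e1 + e2

end IsAdditiveLieDerivation

/-! ### From the Lie identity to the Leibniz rule -/

/-- A map respecting the Peirce decomposition of a faithful pair which is a Lie derivation up to
the central map `g`. -/
structure IsPeirceLieDerivation {R : Type*} [Ring R] (e f : R) (φ g : R →+ R) : Prop where
  pair : IsFaithfulPair e f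
  center : ∀ a, g a ∈ Subring.center R
  map_lie : ∀ a b, φ (a * b - b * a) =
    φ a * b - b * φ a + (a * φ b - φ b * a) - g (a * b - b * a)
  left_diag : ∀ a, e * a = a → a * e = a → e * φ a = φ a
  right_diag : ∀ a, e * a = a → a * e = a → φ a * e = φ a
  left_diag' : ∀ a, f * a = a → a * f = a → f * φ a = φ a
  right_diag' : ∀ a, f * a = a → a * f = a → φ a * f = φ a
  left_off : ∀ a, e * a = a → a * f = a → e * φ a = φ a
  right_off : ∀ a, e * a = a → a * f = a → φ a * f = φ a
  left_off' : ∀ a, f * a = a → a * e = a → f * φ a = φ a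
  right_off' : ∀ a, f * a = a → a * e = a → φ a * e = φ a
  map_off : ∀ a, e * a = a → a * f = a → g a = 0
  map_off' : ∀ a, f * a = a → a * e = a → g a = 0

namespace IsPeirceLieDerivation

variable {R : Type*} [Ring R] {e f : R} {φ g : R →+ R}

theorem symm (h : IsPeirceLieDerivation e f φ g) : IsPeirceLieDerivation f e φ g where
  pair := h.pair.symm
  center := h.center
  map_lie := h.map_lie
  left_diag := h.left_diag'
  right_diag := h.right_diag'
  left_diag' := h.left_diag
  right_diag' := h.right_diag
  left_off := h.left_off'
  right_off := h.right_off'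
  left_off' := h.left_off
  right_off' := h.right_off
  map_off := h.map_off'
  map_off' := h.map_off

/-- Products in the reverse order vanish, so the bracket is a single product, lying off the diagonal
where `g` is zero. -/
theorem map_diag_mul_off (h : IsPeirceLieDerivation e f φ g) {a x : R} (ha : e * a = a)
    (ha' : a * e = a) (hx : e * x = x) (hx' : x * f = x) :
    φ (a * x) = φ a * x + a * φ x := by
  have p := h.pair.symm
  have := h.map_lie a x
  rw [p.mul_eq_zero_of_left_of_right hx' ha,
    p.mul_eq_zero_of_left_of_right hx' (h.left_diag a ha ha'),
    p.mul_eq_zero_of_left_of_right (h.right_off x hx hx') ha, sub_zero, sub_zero, sub_zero,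
    h.map_off (a * x) (by rw [← mul_assoc, ha]) (by rw [mul_assoc, hx']), sub_zero] at this
  exact this

theorem map_off_mul_diag (h : IsPeirceLieDerivation e f φ g) {x b : R} (hx : e * x = x)
    (hx' : x * f = x) (hb : f * b = b) (hb' : b * f = b) :
    φ (x * b) = φ x * b + x * φ b := by
  have p := h.pair.symm
  have := h.map_lie x b
  rw [p.mul_eq_zero_of_left_of_right hb' hx,
    p.mul_eq_zero_of_left_of_right hb' (h.left_off x hx hx'),
    p.mul_eq_zero_of_left_of_right (h.right_diag' b hb hb') hx, sub_zero, sub_zero, sub_zero,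
    h.map_off (x * b) (by rw [← mul_assoc, hx]) (by rw [mul_assoc, hb']), sub_zero] at this
  exact this

/-- Expanding `φ (a * b * x)` in two ways for off-diagonal `x` shows that the Leibniz defect kills
the off-diagonal corner. -/
theorem map_diag_mul_diag (h : IsPeirceLieDerivation e f φ g) {a b : R} (ha : e * a = a)
    (ha' : a * e = a) (hb : e * b = b) (hb' : b * e = b) :
    φ (a * b) = φ a * b + a * φ b := by
  have hab : e * (a * b) = a * b := by rw [← mul_assoc, ha]
  have hab' : a * b * e = a * b := by rw [mul_assoc, hb']
  rw [← sub_eq_zero]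
  refine h.pair.eq_zero_of_forall_mul ?_ fun x hx hx' => ?_
  · rw [sub_mul, add_mul, h.right_diag _ hab hab', mul_assoc, hb', mul_assoc,
      h.right_diag b hb hb']
  · have h1 := h.map_diag_mul_off hab hab' hx hx'
    have h2 := h.map_diag_mul_off hb hb' hx hx'
    have h3 := h.map_diag_mul_off (x := b * x) ha ha' (by rw [← mul_assoc, hb])
      (by rw [mul_assoc, hx'])
    rw [mul_assoc a b x, h3, h2] at h1
    linear_combination (norm := noncomm_ring) -h1

/-- The defect of multiplicativity on opposite off-diagonal corners is central. -/
theorem map_off_mul_off_defect (h : IsPeirceLieDerivation e f φ g) {x y : R} (hx : e * x = x)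
    (hx' : x * f = x) (hy : f * y = y) (hy' : y * e = y) :
    φ (x * y) - φ x * y - x * φ y = - (g (x * y - y * x) * e) := by
  have p := h.pair
  have hxy : e * (x * y) = x * y := by rw [← mul_assoc, hx]
  have hxy' : x * y * e = x * y := by rw [mul_assoc, hy']
  have hyx : f * (y * x) = y * x := by rw [← mul_assoc, hy]
  have hyx' : y * x * f = y * x := by rw [mul_assoc, hx']
  have h1 := h.right_diag _ hxy hxy'
  have h2 := p.symm.mul_right_eq_zero (h.right_diag' _ hyx hyx')
  have h3 := p.symm.mul_right_eq_zero (h.right_off x hx hx')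
  have h4 := h.right_off' y hy hy'
  have h5 := p.symm.mul_right_eq_zero hx'
  have := h.map_lie x y
  rw [map_sub] at this
  linear_combination (norm := noncomm_ring) this * e - h1 + h2 + φ x * hy' + x * h4
    - y * h3 - φ y * h5

/-- With `z = g (x * y - y * x)`, the defects of `x * y` and `y * x` are `-(z * e)` and `z * f`.
Comparing `φ ((x * y) * x)` with `φ (x * (y * x))` therefore leaves `2 * z * x = 0`. -/
theorem mul_eq_zero_of_defect (h : IsPeirceLieDerivation e f φ g)
    (htwo : ∀ a : R, a + a = 0 → a = 0) {x y : R} (hx : e * x = x)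
    (hx' : x * f = x) (hy : f * y = y) (hy' : y * e = y) : g (x * y - y * x) * x = 0 := by
  have hxy : e * (x * y) = x * y := by rw [← mul_assoc, hx]
  have hxy' : x * y * e = x * y := by rw [mul_assoc, hy']
  have hyx : f * (y * x) = y * x := by rw [← mul_assoc, hy]
  have hyx' : y * x * f = y * x := by rw [mul_assoc, hx']
  have d1 := h.map_off_mul_off_defect hx hx' hy hy'
  have d2 := h.symm.map_off_mul_off_defect hy hy' hx hx'
  rw [← neg_sub (x * y), map_neg] at d2
  have m1 := h.map_diag_mul_off hxy hxy' hx hx'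
  have m2 := h.map_off_mul_diag hx hx' hyx hyx'
  rw [← mul_assoc] at m2
  have hz := Subring.mem_center_iff.1 (h.center (x * y - y * x)) x
  apply htwo
  generalize g (x * y - y * x) = z at *
  linear_combination (norm := noncomm_ring) m1 - m2 + d1 * x - x * d2 - z * hx - hz * f - z * hx'

/-- Let `z_x = g (x * y - y * x)`. Polarising `z_x * x = 0` gives `z_x * w + z_w * x = 0`;
multiplication by `z_x` kills the second term, so the square of `z_x` annihilates every off-diagonal
`w`. -/
theorem defect_eq_zero (h : IsPeirceLieDerivation e f φ g)
    (htwo : ∀ a : R, a + a = 0 → a = 0)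
    (hred : ∀ z ∈ Subring.center R, z * z = 0 → z = 0) {x y : R} (hx : e * x = x)
    (hx' : x * f = x) (hy : f * y = y) (hy' : y * e = y) : g (x * y - y * x) = 0 := by
  have hc := h.center (x * y - y * x)
  refine hred _ hc (h.pair.eq_zero_of_center_of_forall_mul (mul_mem hc hc) fun w hw hw' => ?_)
  have h1 := h.mul_eq_zero_of_defect htwo hx hx' hy hy'
  have h2 := h.mul_eq_zero_of_defect htwo hw hw' hy hy'
  have h3 := h.mul_eq_zero_of_defect htwo (x := x + w) (by rw [mul_add, hx, hw])
    (by rw [add_mul, hx', hw']) hy hy'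
  have h4 : (x + w) * y - y * (x + w) = (x * y - y * x) + (w * y - y * w) := by noncomm_ring
  rw [h4, map_add] at h3
  have hz := Subring.mem_center_iff.1 hc (g (w * y - y * w))
  linear_combination (norm := noncomm_ring) g (x * y - y * x) * (h3 - h1 - h2)
    - g (w * y - y * w) * h1 + hz * x

theorem map_off_mul_off (h : IsPeirceLieDerivation e f φ g)
    (htwo : ∀ a : R, a + a = 0 → a = 0)
    (hred : ∀ z ∈ Subring.center R, z * z = 0 → z = 0) {x y : R} (hx : e * x = x)
    (hx' : x * f = x) (hy : f * y = y) (hy' : y * e = y) :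
    φ (x * y) = φ x * y + x * φ y := by
  have := h.map_off_mul_off_defect hx hx' hy hy'
  rw [h.defect_eq_zero htwo hred hx hx' hy hy', zero_mul, neg_zero] at this
  rw [← sub_eq_zero, ← this]
  abel

theorem _root_.IsFaithfulPair.peirce_sum (h : IsFaithfulPair e f) (a : R) :
    a = e * a * e + e * a * f + (f * a * f + f * a * e) := by
  rw [h.eq_sub]; noncomm_ring

/-- Multiplicativity of a derivation with the left factor in the `e`-row. -/
theorem map_row_mul (h : IsPeirceLieDerivation e f φ g)
    (htwo : ∀ a : R, a + a = 0 → a = 0)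
    (hred : ∀ z ∈ Subring.center R, z * z = 0 → z = 0) (a b : R) :
    φ ((e * a * e + e * a * f) * b) =
      φ (e * a * e + e * a * f) * b + (e * a * e + e * a * f) * φ b := by
  have p := h.pair
  have ee : ∀ r, e * (e * r) = e * r := fun r => by rw [← mul_assoc, p.idem]
  have ff : ∀ r, f * (f * r) = f * r := fun r => by rw [← mul_assoc, p.symm.idem]
  have l1 : ∀ r, e * (e * r * e) = e * r * e := fun r => by simp only [mul_assoc, ee]
  have l2 : ∀ r, e * (e * r * f) = e * r * f := fun r => by simp only [mul_assoc, ee]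
  have l3 : ∀ r, f * (f * r * e) = f * r * e := fun r => by simp only [mul_assoc, ff]
  have l4 : ∀ r, f * (f * r * f) = f * r * f := fun r => by simp only [mul_assoc, ff]
  have r1 : ∀ r, e * r * e * e = e * r * e := fun r => by rw [mul_assoc, p.idem]
  have r2 : ∀ r, e * r * f * f = e * r * f := fun r => by rw [mul_assoc, p.symm.idem]
  have r3 : ∀ r, f * r * e * e = f * r * e := fun r => by rw [mul_assoc, p.idem]
  have r4 : ∀ r, f * r * f * f = f * r * f := fun r => by rw [mul_assoc, p.symm.idem]
  have t1 := h.map_diag_mul_diag (l1 a) (r1 a) (l1 b) (r1 b)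
  have t2 := h.map_diag_mul_off (l1 a) (r1 a) (l2 b) (r2 b)
  have t3 := h.map_off_mul_off htwo hred (l2 a) (r2 a) (l3 b) (r3 b)
  have t4 := h.map_off_mul_diag (l2 a) (r2 a) (l4 b) (r4 b)
  have A11 := h.right_diag _ (l1 a) (r1 a)
  have A12 := h.right_off _ (l2 a) (r2 a)
  have B11 := h.left_diag _ (l1 b) (r1 b)
  have B12 := h.left_off _ (l2 b) (r2 b)
  have B21 := h.left_off' _ (l3 b) (r3 b)
  have B22 := h.left_diag' _ (l4 b) (r4 b)
  rw [p.peirce_sum b]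
  simp only [map_add, mul_add, add_mul, t1, t2, t3, t4,
    p.mul_eq_zero_of_left_of_right (r1 a) (l3 b), p.mul_eq_zero_of_left_of_right (r1 a) (l4 b),
    p.symm.mul_eq_zero_of_left_of_right (r2 a) (l1 b),
    p.symm.mul_eq_zero_of_left_of_right (r2 a) (l2 b),
    p.mul_eq_zero_of_left_of_right A11 (l3 b), p.mul_eq_zero_of_left_of_right A11 (l4 b),
    p.symm.mul_eq_zero_of_left_of_right A12 (l1 b),
    p.symm.mul_eq_zero_of_left_of_right A12 (l2 b),
    p.mul_eq_zero_of_left_of_right (r1 a) B21, p.mul_eq_zero_of_left_of_right (r1 a) B22,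
    p.symm.mul_eq_zero_of_left_of_right (r2 a) B11,
    p.symm.mul_eq_zero_of_left_of_right (r2 a) B12, map_zero]
  abel

theorem isAdditiveDerivation (h : IsPeirceLieDerivation e f φ g)
    (htwo : ∀ a : R, a + a = 0 → a = 0)
    (hred : ∀ z ∈ Subring.center R, z * z = 0 → z = 0) : IsAdditiveDerivation φ := by
  intro a b
  have h1 := h.map_row_mul htwo hred a b
  have h2 := h.symm.map_row_mul htwo hred a b
  have h3 := h.pair.peirce_sum a
  generalize e * a * e + e * a * f = u at *
  generalize f * a * f + f * a * e = v at *
  subst h3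
  rw [add_mul, map_add, h1, h2, map_add, add_mul, add_mul]
  abel

end IsPeirceLieDerivation

/-! ### Splitting off the central part -/

namespace IsAdditiveLieDerivation

variable {R : Type*} [Ring R] {e f : R} {L : R →+ R}

/-- A central element is determined by its product with `f`, so pointwise choices are automatically
additive. -/
theorem exists_centralPart (hL : IsAdditiveLieDerivation L) (h : IsFaithfulPair e f)
    (hLe : L e ∈ Subring.center R) (hLf : L f ∈ Subring.center R) :
    ∃ g : R →+ R, (∀ a, g a ∈ Subring.center R) ∧ ∀ a, L (e * a * e) * f = g a * f := by
  have ex : ∀ a, ∃ z ∈ Subring.center R, L (e * a * e) * f = z * f := fun a =>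
    hL.exists_center_of_diagonal h hLe hLf (by simp only [← mul_assoc, h.idem])
      (by rw [mul_assoc, h.idem])
  choose g hg hgf using ex
  refine ⟨AddMonoidHom.mk' g fun a b => ?_, hg, hgf⟩
  rw [← sub_eq_zero]
  refine h.symm.eq_zero_of_center (sub_mem (hg _) (add_mem (hg _) (hg _))) ?_
  rw [sub_mul, add_mul, ← hgf, ← hgf, ← hgf, mul_add, add_mul, map_add, add_mul, sub_self]

/-- Here `g₁` and `g₂` record the components of `L` on each diagonal corner that fall in the
opposite one. Both vanish off the diagonal, so `L - (g₁ + g₂)` preserves all four corners. -/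
theorem exists_eq_add_of_map_mem_center (hL : IsAdditiveLieDerivation L)
    (h : IsFaithfulPair e f) (htwo : ∀ a : R, a + a = 0 → a = 0)
    (hred : ∀ z ∈ Subring.center R, z * z = 0 → z = 0) (hLe : L e ∈ Subring.center R) :
    ∃ φ g : R →+ R, IsAdditiveDerivation φ ∧ (∀ a, g a ∈ Subring.center R) ∧ L = φ + g := by
  have hLf : L f ∈ Subring.center R := by
    rw [h.eq_sub, map_sub]; exact sub_mem hL.map_one_mem_center hLe
  obtain ⟨g₁, hg₁, hgf⟩ := hL.exists_centralPart h hLe hLf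
  obtain ⟨g₂, hg₂, hge⟩ := hL.exists_centralPart h.symm hLf hLe
  have v₁ : ∀ a, e * a * e = 0 → g₁ a = 0 := fun a ha =>
    h.symm.eq_zero_of_center (hg₁ a) (by rw [← hgf, ha, map_zero, zero_mul])
  have v₂ : ∀ a, f * a * f = 0 → g₂ a = 0 := fun a ha =>
    h.eq_zero_of_center (hg₂ a) (by rw [← hge, ha, map_zero, zero_mul])
  have hc : ∀ a, (g₁ + g₂) a ∈ Subring.center R := fun a => add_mem (hg₁ a) (hg₂ a)
  have hoff : ∀ a, e * a = a → a * f = a → (g₁ + g₂) a = 0 := fun a ha ha' => by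
    rw [AddMonoidHom.add_apply, v₁ a, v₂ a, add_zero]
    · rw [h.left_mul_eq_zero ha, zero_mul]
    · rw [ha, h.symm.mul_right_eq_zero ha']
  have hoff' : ∀ a, f * a = a → a * e = a → (g₁ + g₂) a = 0 := fun a ha ha' => by
    rw [AddMonoidHom.add_apply, v₁ a, v₂ a, add_zero]
    · rw [ha, h.mul_right_eq_zero ha']
    · rw [h.symm.left_mul_eq_zero ha, zero_mul]
  have hdiag : ∀ a, e * a = a → a * e = a → (L - (g₁ + g₂)) a * e = (L - (g₁ + g₂)) a := by
    intro a ha ha'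
    refine h.mul_right_eq_self ?_
    rw [AddMonoidHom.sub_apply, AddMonoidHom.add_apply,
      v₂ a (by rw [h.left_mul_eq_zero ha, zero_mul]), add_zero, sub_mul, ← hgf, ha, ha', sub_self]
  have hdiag' : ∀ a, f * a = a → a * f = a → (L - (g₁ + g₂)) a * f = (L - (g₁ + g₂)) a := by
    intro a ha ha'
    refine h.symm.mul_right_eq_self ?_
    rw [AddMonoidHom.sub_apply, AddMonoidHom.add_apply,
      v₁ a (by rw [h.symm.left_mul_eq_zero ha, zero_mul]), zero_add, sub_mul, ← hge, ha, ha',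
      sub_self]
  have key : IsPeirceLieDerivation e f (L - (g₁ + g₂)) (g₁ + g₂) :=
    { pair := h
      center := hc
      map_lie := fun a b => by
        have h1 := hL a b
        simp only [Ring.lie_def] at h1
        have h2 := Subring.mem_center_iff.1 (hc a) b
        have h3 := Subring.mem_center_iff.1 (hc b) a
        simp only [AddMonoidHom.sub_apply]
        linear_combination (norm := noncomm_ring) h1 - h2 + h3
      left_diag := fun a ha ha' => by
        have h1 := hL.map_diagonal hLe ha ha'
        have h2 := Subring.mem_center_iff.1 (hc a) e
        rw [← hdiag a ha ha', ← mul_assoc, AddMonoidHom.sub_apply, mul_sub, h1, h2, ← sub_mul,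
          mul_assoc, h.idem]
      right_diag := hdiag
      left_diag' := fun a ha ha' => by
        have h1 := hL.map_diagonal hLf ha ha'
        have h2 := Subring.mem_center_iff.1 (hc a) f
        rw [← hdiag' a ha ha', ← mul_assoc, AddMonoidHom.sub_apply, mul_sub, h1, h2, ← sub_mul,
          mul_assoc, h.symm.idem]
      right_diag' := hdiag'
      left_off := fun a ha ha' => by
        rw [AddMonoidHom.sub_apply, hoff a ha ha', sub_zero]
        exact (hL.map_offDiagonal h htwo hLe ha ha').1
      right_off := fun a ha ha' => by
        rw [AddMonoidHom.sub_apply, hoff a ha ha', sub_zero]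
        exact (hL.map_offDiagonal h htwo hLe ha ha').2
      left_off' := fun a ha ha' => by
        rw [AddMonoidHom.sub_apply, hoff' a ha ha', sub_zero]
        exact (hL.map_offDiagonal h.symm htwo hLf ha ha').1
      right_off' := fun a ha ha' => by
        rw [AddMonoidHom.sub_apply, hoff' a ha ha', sub_zero]
        exact (hL.map_offDiagonal h.symm htwo hLf ha ha').2
      map_off := hoff
      map_off' := hoff' }
  exact ⟨_, _, key.isAdditiveDerivation htwo hred, hc, (sub_add_cancel _ _).symm⟩

/-- The inner derivation `a ↦ a s - s a`. -/
def _root_.innerDerivation (s : R) : R →+ R := AddMonoidHom.mulRight s - AddMonoidHom.mulLeft s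

theorem _root_.innerDerivation_apply (s a : R) : innerDerivation s a = a * s - s * a := rfl

/-- A block diagonal element commuting with the off-diagonal corners commutes with the
diagonal ones. -/
theorem _root_.IsFaithfulPair.commute_diag (h : IsFaithfulPair e f) {c a : R} (hc : c * e = e * c)
    (hcx : ∀ x, e * x = x → x * f = x → c * x = x * c) (ha : e * a = a) (ha' : a * e = a) :
    c * a = a * c := by
  rw [← sub_eq_zero]
  refine h.eq_zero_of_forall_mul ?_ fun x hx hx' => ?_
  · linear_combination (norm := noncomm_ring) c * ha' - a * hc - ha' * c
  · have h1 := hcx x hx hx'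
    have h2 := hcx (a * x) (by rw [← mul_assoc, ha]) (by rw [mul_assoc, hx'])
    linear_combination (norm := noncomm_ring) h2 - a * h1

theorem _root_.IsFaithfulPair.mem_center (h : IsFaithfulPair e f) {c : R} (hc : c * e = e * c)
    (hcx : ∀ x, e * x = x → x * f = x → c * x = x * c)
    (hcy : ∀ x, f * x = x → x * e = x → c * x = x * c) : c ∈ Subring.center R := by
  have hc' : c * f = f * c := by
    rw [h.eq_sub]; linear_combination (norm := noncomm_ring) -hc
  rw [Subring.mem_center_iff]
  intro a
  have i1 := h.idem
  have i2 := h.symm.idem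
  have h1 := h.commute_diag (a := e * a * e) hc hcx (by simp only [← mul_assoc, i1])
    (by simp only [mul_assoc, i1])
  have h2 := h.symm.commute_diag (a := f * a * f) hc' hcy (by simp only [← mul_assoc, i2])
    (by simp only [mul_assoc, i2])
  have h3 := hcx (e * a * f) (by simp only [← mul_assoc, i1]) (by simp only [mul_assoc, i2])
  have h4 := hcy (f * a * e) (by simp only [← mul_assoc, i2]) (by simp only [mul_assoc, i1])
  have h5 := h.peirce_sum a
  generalize e * a * e = a₁ at *
  generalize e * a * f = a₂ at *
  generalize f * a * f = a₃ at *
  generalize f * a * e = a₄ at *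
  rw [h5]
  linear_combination (norm := noncomm_ring) -h1 - h2 - h3 - h4

/-- The diagonal part of `L e` commutes with the off-diagonal corner. -/
theorem diagonal_mul_comm (hL : IsAdditiveLieDerivation L) (h : IsFaithfulPair e f) {x : R}
    (hx : e * x = x) (hx' : x * f = x) :
    (e * L e * e + f * L e * f) * x = x * (e * L e * e + f * L e * f) := by
  have hxe : x * e = 0 := h.symm.mul_right_eq_zero hx'
  have hfx : f * x = 0 := h.left_mul_eq_zero hx
  -- As `[e, x] = x`, compressing by `e` and `f` cancels `e * L x * f` from both sides and leaves `e
  -- * L e * x = x * L e * f`.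
  have key := hL e x
  simp only [Ring.lie_def, hx, hxe, sub_zero] at key
  have k2 : e * (L x * (e * f)) = 0 := by rw [h.mul_eq_zero, mul_zero, mul_zero]
  have k3 : e * (e * L x) * f = e * L x * f := by rw [← mul_assoc, h.idem]
  have k4 : e * L e * (e * x) = e * L e * x := by rw [hx]
  have k5 : x * f * L e * f = x * L e * f := by rw [hx']
  have k6 : e * (L e * (x * f)) = e * L e * x := by rw [hx', ← mul_assoc]
  have k7 : e * x * L e * f = x * L e * f := by rw [hx]
  linear_combination (norm := noncomm_ring) -e * key * f + k4 - k5 - k6 + k7 + f * L e * hfx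
    - hxe * L e * e + k2 - k3

theorem diagonal_mul_comm' (hL : IsAdditiveLieDerivation L) (h : IsFaithfulPair e f) {x : R}
    (hx : f * x = x) (hx' : x * e = x) :
    (e * L e * e + f * L e * f) * x = x * (e * L e * e + f * L e * f) := by
  have hxf : x * f = 0 := h.mul_right_eq_zero hx'
  have hex : e * x = 0 := h.symm.left_mul_eq_zero hx
  have key := hL e x
  simp only [Ring.lie_def, hx', hex, zero_sub, map_neg] at key
  have k2 : f * e * L x * e = 0 := by rw [h.symm.mul_eq_zero, zero_mul, zero_mul]
  have k3 : f * L x * (e * e) = f * L x * e := by rw [h.idem]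
  have k4 : f * L e * (f * x) = f * L e * x := by rw [hx]
  have k5 : x * e * L e * e = x * L e * e := by rw [hx']
  have k6 : f * (L e * (x * e)) = f * L e * x := by rw [hx', ← mul_assoc]
  have k7 : f * x * L e * e = x * L e * e := by rw [hx]
  linear_combination (norm := noncomm_ring) -f * key * e + k4 - k5 - k6 + k7 + e * L e * hex
    - hxf * L e * f - k2 + k3

/-- The off-diagonal part of `L e` is the value at `e` of an inner derivation. -/
theorem sub_innerDerivation_mem_center (hL : IsAdditiveLieDerivation L) (h : IsFaithfulPair e f) :
    (L - innerDerivation (e * L e * f - f * L e * e)) e ∈ Subring.center R := by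
  have i1 := h.idem
  have i2 := h.symm.idem
  have z1 := h.mul_eq_zero
  have z2 := h.symm.mul_eq_zero
  have h1 : (L - innerDerivation (e * L e * f - f * L e * e)) e = e * L e * e + f * L e * f := by
    have h2 := h.peirce_sum (L e)
    rw [AddMonoidHom.sub_apply, innerDerivation_apply]
    generalize L e = t at *
    linear_combination (norm := noncomm_ring) h2 - i1 * t * f + z1 * t * e + e * t * z2
      - f * t * i1
  rw [h1]
  refine h.mem_center ?_ (fun x => hL.diagonal_mul_comm h) fun x hx hx' => ?_
  · linear_combination (norm := noncomm_ring) e * L e * i1 + f * L e * z2 - i1 * L e * e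
      - z1 * L e * f
  · exact hL.diagonal_mul_comm' h hx hx'

theorem exists_eq_add (hL : IsAdditiveLieDerivation L)
    (h : IsFaithfulPair e f) (htwo : ∀ a : R, a + a = 0 → a = 0)
    (hred : ∀ z ∈ Subring.center R, z * z = 0 → z = 0) :
    ∃ φ g : R →+ R, IsAdditiveDerivation φ ∧ (∀ a, g a ∈ Subring.center R) ∧
      (∀ a b : R, g ⁅a, b⁆ = 0) ∧ L = φ + g := by
  set s := e * L e * f - f * L e * e with hs
  have hL' : IsAdditiveLieDerivation (L - innerDerivation s) := by
    intro a b
    have := hL a b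
    simp only [Ring.lie_def, AddMonoidHom.sub_apply, innerDerivation_apply] at this ⊢
    linear_combination (norm := noncomm_ring) this
  obtain ⟨φ, g, hφ, hg, hLg⟩ := hL'.exists_eq_add_of_map_mem_center h htwo hred
    (hL.sub_innerDerivation_mem_center h)
  have hder : IsAdditiveDerivation (φ + innerDerivation s) := by
    intro a b
    have := hφ a b
    simp only [AddMonoidHom.add_apply, innerDerivation_apply] at this ⊢
    linear_combination (norm := noncomm_ring) this
  have hsum : L = (φ + innerDerivation s) + g := by
    rw [add_right_comm, ← hLg, sub_add_cancel]
  -- `L` and its derivation part both satisfy the Lie identity, and central values of `g` drop out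
  -- of brackets, so `g` kills commutators.
  refine ⟨_, g, hder, hg, fun a b => ?_, hsum⟩
  have h1 := hL a b
  rw [hsum] at h1
  have h2 := Subring.mem_center_iff.1 (hg a) b
  have h3 := Subring.mem_center_iff.1 (hg b) a
  have h4 := hder a b
  have h5 := hder b a
  generalize φ + innerDerivation s = ψ at *
  simp only [Ring.lie_def, AddMonoidHom.add_apply, map_sub] at h1 ⊢
  linear_combination (norm := noncomm_ring) h1 - h4 + h5 - h2 + h3

end IsAdditiveLieDerivation

/-! ### A norm estimate from order bounds -/

section CStarAlgebra

variable {𝓐 : Type*} [CStarAlgebra 𝓐] [PartialOrder 𝓐] [StarOrderedRing 𝓐]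

theorem IsSelfAdjoint.norm_le_of_neg_le_of_le {d : 𝓐} {c : ℝ} (hd : IsSelfAdjoint d)
    (h₁ : -algebraMap ℝ 𝓐 c ≤ d) (h₂ : d ≤ algebraMap ℝ 𝓐 c) (hc : 0 ≤ c) : ‖d‖ ≤ c := by
  cases subsingleton_or_nontrivial 𝓐
  · rwa [Subsingleton.elim d 0, norm_zero]
  rcases CStarAlgebra.norm_or_neg_norm_mem_spectrum hd with h | h
  · exact (le_algebraMap_iff_spectrum_le hd).1 h₂ _ h
  · rw [← map_neg] at h₁
    linarith [(algebraMap_le_iff_le_spectrum hd).1 h₁ _ h]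

/-- The hypotheses place `a - c • (e - f)` between `-c • (e + f)` and `c • (e + f)`. This is the
halving step of the binary expansion. -/
theorem norm_sub_smul_sub_le {a p n e f : 𝓐} {c : ℝ} (hc : 0 ≤ c) (ha : p - n = a) (hp : 0 ≤ p)
    (hn : 0 ≤ n) (he : IsSelfAdjoint e) (hf : IsSelfAdjoint f) (hpe : p ≤ (2 * c) • e)
    (hnf : n ≤ (2 * c) • f) (hef : e + f ≤ 1) : ‖a - c • (e - f)‖ ≤ c := by
  have h4 : c • e + c • f ≤ algebraMap ℝ 𝓐 c := by
    rw [← smul_add, Algebra.algebraMap_eq_smul_one]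
    exact smul_le_smul_of_nonneg_left hef hc
  subst ha
  have hsa : IsSelfAdjoint (p - n - c • (e - f)) :=
    ((IsSelfAdjoint.of_nonneg hp).sub (.of_nonneg hn)).sub
      ((IsSelfAdjoint.all c).smul (he.sub hf))
  refine hsa.norm_le_of_neg_le_of_le ?_ ?_ hc
  · calc -algebraMap ℝ 𝓐 c
        ≤ -(c • e + c • f) := neg_le_neg h4
      _ = 0 - (2 * c) • f - c • (e - f) := by module
      _ ≤ p - n - c • (e - f) := sub_le_sub_right (sub_le_sub hp hnf) _
  · calc p - n - c • (e - f)
        ≤ (2 * c) • e - 0 - c • (e - f) := sub_le_sub_right (sub_le_sub hpe hn) _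
      _ = c • e + c • f := by module
      _ ≤ _ := h4

end CStarAlgebra

/-! ### Range projections and the spectral series of a self-adjoint operator -/

section HilbertSpace

variable {H : Type*} [NormedAddCommGroup H] [InnerProductSpace ℂ H] [CompleteSpace H]

open ContinuousLinearMap

/-- The orthogonal projection onto the closed linear span of a set. -/
noncomputable def spanProjection (S : Set H) : H →L[ℂ] H :=
  (Submodule.span ℂ S).topologicalClosure.starProjection

theorem isStarProjection_spanProjection (S : Set H) : IsStarProjection (spanProjection S) :=
  isStarProjection_starProjection

theorem spanProjection_apply_of_mem {S : Set H} {v : H} (hv : v ∈ S) : spanProjection S v = v :=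
  Submodule.starProjection_eq_self_iff.2
    (Submodule.le_topologicalClosure _ (Submodule.subset_span hv))

theorem eqOn_spanProjection {S : Set H} {Q Q' : H →L[ℂ] H} (h : ∀ v ∈ S, Q v = Q' v) :
    Q * spanProjection S = Q' * spanProjection S := by
  ext v
  have hle : (Submodule.span ℂ S).topologicalClosure ≤ LinearMap.eqLocus (Q : H →ₗ[ℂ] H) (Q' : H →ₗ[ℂ] H) :=
    Submodule.topologicalClosure_minimal _ (Submodule.span_le.2 h)
      (isClosed_eq Q.continuous Q'.continuous)
  exact hle (Submodule.starProjection_apply_mem _ v)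

theorem spanProjection_mul_mul {S : Set H} {T : H →L[ℂ] H} (hT : ∀ v ∈ S, T v ∈ S) :
    spanProjection S * T * spanProjection S = T * spanProjection S :=
  eqOn_spanProjection fun v hv => spanProjection_apply_of_mem (hT v hv)

/-- A closed subspace invariant under `T` and its adjoint reduces `T`. -/
theorem commute_spanProjection {S : Set H} {T : H →L[ℂ] H} (hT : ∀ v ∈ S, T v ∈ S)
    (hT' : ∀ v ∈ S, star T v ∈ S) : Commute (spanProjection S) T := by
  have h1 := spanProjection_mul_mul hT
  have h2 := congr_arg star (spanProjection_mul_mul hT')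
  have h3 := (isStarProjection_spanProjection S).isSelfAdjoint.star_eq
  simp only [star_mul, star_star, h3] at h2
  rw [commute_iff_eq, ← h2, ← h1, mul_assoc, ← mul_assoc (spanProjection S) (spanProjection S),
    (isStarProjection_spanProjection S).isIdempotentElem.eq]

/-- The range projection of an operator. -/
noncomputable def rangeProjection (A : H →L[ℂ] H) : H →L[ℂ] H := spanProjection (Set.range A)

theorem isStarProjection_rangeProjection (A : H →L[ℂ] H) : IsStarProjection (rangeProjection A) :=
  isStarProjection_spanProjection _

theorem rangeProjection_mul_self (A : H →L[ℂ] H) : rangeProjection A * A = A := by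
  ext v
  exact spanProjection_apply_of_mem ⟨v, rfl⟩

theorem mul_rangeProjection_eq_zero {A B : H →L[ℂ] H} (h : B * A = 0) :
    B * rangeProjection A = 0 := by
  have : B * rangeProjection A = 0 * rangeProjection A := by
    refine eqOn_spanProjection ?_
    rintro _ ⟨v, rfl⟩
    exact DFunLike.congr_fun h v
  rw [this, zero_mul]

theorem rangeProjection_mul_eq_zero {A B : H →L[ℂ] H} (hA : IsSelfAdjoint A) (h : A * B = 0) :
    rangeProjection A * B = 0 := by
  have h1 : star B * A = 0 := by rw [← hA.star_eq, ← star_mul, h, star_zero]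
  have h2 := congr_arg star (mul_rangeProjection_eq_zero h1)
  rwa [star_mul, star_star, (isStarProjection_rangeProjection A).isSelfAdjoint.star_eq,
    star_zero] at h2

theorem commute_rangeProjection {A B : H →L[ℂ] H} (hA : IsSelfAdjoint A) (h : Commute A B) :
    Commute (rangeProjection A) B := by
  have h' : Commute A (star B) := by simpa [hA.star_eq] using h.star_star
  refine commute_spanProjection ?_ ?_
  · rintro _ ⟨v, rfl⟩
    exact ⟨B v, DFunLike.congr_fun h.eq v⟩
  · rintro _ ⟨v, rfl⟩
    exact ⟨star B v, DFunLike.congr_fun h'.eq v⟩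

/-- Since `A⁺ * A = A⁺ * A⁺`, the equation `A * B = 0` makes `star (A⁺ * B) * (A⁺ * B)` vanish. -/
theorem rangeProjection_posPart_mul_eq_zero {A B : H →L[ℂ] H} (hA : IsSelfAdjoint A)
    (h : A * B = 0) : rangeProjection A⁺ * B = 0 := by
  have hp : IsSelfAdjoint A⁺ := .of_nonneg (CFC.posPart_nonneg A)
  refine rangeProjection_mul_eq_zero hp ?_
  rw [← CStarRing.star_mul_self_eq_zero_iff, star_mul, hp.star_eq]
  have : A⁺ * A = A⁺ * A⁺ := by
    have h1 := congr_arg (A⁺ * ·) (CFC.posPart_sub_negPart A hA)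
    simpa only [mul_sub, CFC.posPart_mul_negPart, sub_zero] using h1.symm
  rw [mul_assoc, ← mul_assoc A⁺, ← this, mul_assoc, h, mul_zero, mul_zero]

theorem commute_rangeProjection_posPart {A B : H →L[ℂ] H} (h : Commute A B) :
    Commute (rangeProjection A⁺) B :=
  commute_rangeProjection (.of_nonneg (CFC.posPart_nonneg A)) (h.cfcₙ_real _)

theorem posPart_le_smul_rangeProjection {A : H →L[ℂ] H} {c : ℝ} (hc : ‖A‖ ≤ c) :
    A⁺ ≤ c • rangeProjection A⁺ := by
  have hp : IsSelfAdjoint A⁺ := .of_nonneg (CFC.posPart_nonneg A)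
  have hE := isStarProjection_rangeProjection A⁺
  have h1 := rangeProjection_mul_self A⁺
  have h2 : A⁺ * rangeProjection A⁺ = A⁺ := by
    have := congr_arg star h1
    rwa [star_mul, hp.star_eq, hE.isSelfAdjoint.star_eq] at this
  have h3 : A⁺ ≤ algebraMap ℝ (H →L[ℂ] H) c :=
    (CStarAlgebra.norm_le_iff_le_algebraMap _ ((norm_nonneg A).trans hc)
      (CFC.posPart_nonneg A)).1 ((CStarAlgebra.norm_posPart_le A).trans hc)
  have h4 := IsSelfAdjoint.conjugate_le_conjugate h3 hE.isSelfAdjoint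
  rwa [h1, h2, Algebra.algebraMap_eq_smul_one, mul_smul_comm, mul_one, smul_mul_assoc,
    hE.isIdempotentElem.eq] at h4

/-- A self-adjoint operator is within half its norm of a real multiple of the difference of the
range projections of its positive and negative parts. -/
theorem norm_sub_smul_rangeProjection_le {A : H →L[ℂ] H} {c : ℝ} (hA : IsSelfAdjoint A)
    (hc : ‖A‖ ≤ 2 * c) : ‖A - c • (rangeProjection A⁺ - rangeProjection A⁻)‖ ≤ c := by
  have h0 : 0 ≤ c := by linarith [norm_nonneg A]
  have h1 := posPart_le_smul_rangeProjection hc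
  have h2 : A⁻ ≤ (2 * c) • rangeProjection A⁻ := by
    rw [← CFC.posPart_neg]
    exact posPart_le_smul_rangeProjection (by rwa [norm_neg])
  have hE := isStarProjection_rangeProjection A⁺
  have hF := isStarProjection_rangeProjection A⁻
  have hEF : rangeProjection A⁺ * rangeProjection A⁻ = 0 :=
    mul_rangeProjection_eq_zero (rangeProjection_mul_eq_zero
      (.of_nonneg (CFC.posPart_nonneg A)) (CFC.posPart_mul_negPart A))
  have h3 : rangeProjection A⁺ + rangeProjection A⁻ ≤ 1 := (hE.add hF hEF).le_one
  exact norm_sub_smul_sub_le h0 (CFC.posPart_sub_negPart A hA) (CFC.posPart_nonneg A)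
    (CFC.negPart_nonneg A) hE.isSelfAdjoint hF.isSelfAdjoint h1 h2 h3

/-- The projections which commute with the commutant of `A` and whose range is contained in the
closure of the range of `A`, for self-adjoint `A`. -/
structure IsSpectralProjection (A E : H →L[ℂ] H) : Prop where
  isStarProjection : IsStarProjection E
  commute : ∀ B, Commute A B → Commute E B
  mul_eq_zero : ∀ B, A * B = 0 → E * B = 0

theorem isSpectralProjection_rangeProjection_posPart {A : H →L[ℂ] H} (hA : IsSelfAdjoint A) :
    IsSpectralProjection A (rangeProjection A⁺) :=
  ⟨isStarProjection_rangeProjection _, fun _ => commute_rangeProjection_posPart,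
    fun _ => rangeProjection_posPart_mul_eq_zero hA⟩

theorem isSpectralProjection_rangeProjection_negPart {A : H →L[ℂ] H} (hA : IsSelfAdjoint A) :
    IsSpectralProjection A (rangeProjection A⁻) := by
  rw [← CFC.posPart_neg]
  have := isSpectralProjection_rangeProjection_posPart hA.neg
  exact ⟨this.1, fun B hB => this.2 B hB.neg_left, fun B hB => this.3 B (by rw [neg_mul, hB, neg_zero])⟩

/-- The remainders of the binary expansion of a self-adjoint operator into projections. -/
noncomputable def binaryRemainder (A : H →L[ℂ] H) : ℕ → H →L[ℂ] H
  | 0 => A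
  | n + 1 => binaryRemainder A n - (‖A‖ / 2 ^ (n + 1)) •
      (rangeProjection (binaryRemainder A n)⁺ - rangeProjection (binaryRemainder A n)⁻)

theorem binaryRemainder_spec {A : H →L[ℂ] H} (hA : IsSelfAdjoint A) (n : ℕ) :
    IsSelfAdjoint (binaryRemainder A n) ∧ ‖binaryRemainder A n‖ ≤ ‖A‖ / 2 ^ n ∧
      (∀ B, Commute A B → Commute (binaryRemainder A n) B) ∧
      ∀ B, A * B = 0 → binaryRemainder A n * B = 0 := by
  induction n with
  | zero => exact ⟨hA, by simp [binaryRemainder], fun _ h => h, fun _ h => h⟩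
  | succ n ih =>
    obtain ⟨h1, h2, h3, h4⟩ := ih
    have hE := isSpectralProjection_rangeProjection_posPart h1
    have hF := isSpectralProjection_rangeProjection_negPart h1
    refine ⟨?_, ?_, fun B hB => ?_, fun B hB => ?_⟩
    · exact h1.sub ((IsSelfAdjoint.all _).smul (hE.1.isSelfAdjoint.sub hF.1.isSelfAdjoint))
    -- The coefficient `‖A‖ / 2 ^ (n + 1)` is half the bound on the previous remainder, as the
    -- estimate requires.
    · refine norm_sub_smul_rangeProjection_le h1 (h2.trans_eq ?_)
      rw [pow_succ]; field_simp
    · exact (h3 B hB).sub_left (((hE.2 B (h3 B hB)).sub_left (hF.2 B (h3 B hB))).smul_left _)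
    · rw [binaryRemainder, sub_mul, smul_mul_assoc, sub_mul, h4 B hB, hE.3 B (h4 B hB),
        hF.3 B (h4 B hB), sub_zero, smul_zero, sub_zero]

/-- A self-adjoint operator is a norm-convergent series of multiples of differences of
spectral projections. -/
theorem exists_hasSum_isSpectralProjection {A : H →L[ℂ] H} (hA : IsSelfAdjoint A) :
    ∃ E F : ℕ → H →L[ℂ] H, (∀ n, IsSpectralProjection A (E n)) ∧
      (∀ n, IsSpectralProjection A (F n)) ∧
      HasSum (fun n => (‖A‖ / 2 ^ (n + 1)) • (E n - F n)) A := by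
  have hs := binaryRemainder_spec hA
  have hE := fun n => isSpectralProjection_rangeProjection_posPart (hs n).1
  have hF := fun n => isSpectralProjection_rangeProjection_negPart (hs n).1
  refine ⟨fun n => rangeProjection (binaryRemainder A n)⁺,
    fun n => rangeProjection (binaryRemainder A n)⁻,
    fun n => ⟨(hE n).1, fun B hB => (hE n).2 B ((hs n).2.2.1 B hB),
      fun B hB => (hE n).3 B ((hs n).2.2.2 B hB)⟩,
    fun n => ⟨(hF n).1, fun B hB => (hF n).2 B ((hs n).2.2.1 B hB),
      fun B hB => (hF n).3 B ((hs n).2.2.2 B hB)⟩, ?_⟩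
  have hlim : Filter.Tendsto (fun n : ℕ => ‖A‖ / 2 ^ n) Filter.atTop (nhds 0) := by
    have := (tendsto_pow_atTop_nhds_zero_of_lt_one (r := (1 / 2 : ℝ)) (by norm_num)
      (by norm_num)).const_mul ‖A‖
    simpa [div_eq_mul_inv] using this
  -- The series telescopes to `A` minus a remainder that tends to zero in norm.
  have hterm : ∀ n, (‖A‖ / 2 ^ (n + 1)) • (rangeProjection (binaryRemainder A n)⁺ -
      rangeProjection (binaryRemainder A n)⁻) = binaryRemainder A n - binaryRemainder A (n + 1) :=
    fun n => by rw [binaryRemainder, sub_sub_cancel]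
  simp only [hterm]
  have hsum : Summable fun n => binaryRemainder A n - binaryRemainder A (n + 1) := by
    refine Summable.of_norm_bounded (g := fun n : ℕ => (2 * ‖A‖) * (1 / 2 : ℝ) ^ n)
      (summable_geometric_two.mul_left _) fun n => ?_
    have h1 := (hs n).2.1
    have h2 := (hs (n + 1)).2.1
    have h3 : ‖A‖ / 2 ^ (n + 1) ≤ ‖A‖ / 2 ^ n := by
      gcongr <;> norm_num
    calc _ ≤ ‖binaryRemainder A n‖ + ‖binaryRemainder A (n + 1)‖ := norm_sub_le _ _
      _ ≤ ‖A‖ / 2 ^ n + ‖A‖ / 2 ^ n := by linarith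
      _ = _ := by rw [one_div, inv_pow]; ring
  rw [hsum.hasSum_iff_tendsto_nat]
  simp only [Finset.sum_range_sub']
  have : Filter.Tendsto (binaryRemainder A) Filter.atTop (nhds 0) :=
    squeeze_zero_norm (fun n => (hs n).2.1) hlim
  simpa [binaryRemainder] using this.const_sub (binaryRemainder A 0)

end HilbertSpace

/-! ### Membership in a von Neumann algebra through its commutant -/

namespace VonNeumannAlgebra

variable {H : Type*} [NormedAddCommGroup H] [InnerProductSpace ℂ H] [CompleteSpace H]
  {M : VonNeumannAlgebra H}

theorem eq_zero_of_mul_star_mul_eq_zero {y : H →L[ℂ] H} (h : y * star y * y = 0) : y = 0 := by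
  rw [← CStarRing.star_mul_self_eq_zero_iff, ← CStarRing.star_mul_self_eq_zero_iff]
  have : star (star y * y) * (star y * y) = star y * (y * star y * y) := by
    simp only [star_mul, star_star, mul_assoc]
  rw [this, h, mul_zero]

/-- A property closed under linear combinations passes from the self-adjoint parts of an operator
to the operator. -/
theorem of_selfAdjoint_parts {p : (H →L[ℂ] H) → Prop} (hadd : ∀ a b, p a → p b → p (a + b))
    (hsmul : ∀ (c : ℂ) a, p a → p (c • a)) {a : H →L[ℂ] H} (h₁ : p (a + star a))
    (h₂ : p (Complex.I • (star a - a))) : p a := by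
  have h3 : a = (1 / 2 : ℂ) • (a + star a) + (Complex.I / 2) • (Complex.I • (star a - a)) := by
    rw [smul_smul, div_mul_eq_mul_div, Complex.I_mul_I]
    module
  rw [h3]
  exact hadd _ _ (hsmul _ _ h₁) (hsmul _ _ h₂)

theorem isSelfAdjoint_I_smul (a : H →L[ℂ] H) : IsSelfAdjoint (Complex.I • (star a - a)) := by
  rw [isSelfAdjoint_iff, star_smul, star_sub, star_star, Complex.star_def, Complex.conj_I]
  module

theorem smul_mem {a : H →L[ℂ] H} (c : ℂ) (ha : a ∈ M) : c • a ∈ M :=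
  M.toStarSubalgebra.smul_mem ha c

theorem mem_of_commute {a : H →L[ℂ] H} (h : ∀ y ∈ M.commutant, Commute a y) : a ∈ M := by
  rw [← M.commutant_commutant, mem_commutant_iff]
  exact fun y hy => (h y hy).eq.symm

theorem commute_of_mem {a y : H →L[ℂ] H} (ha : a ∈ M) (hy : y ∈ M.commutant) : Commute a y :=
  mem_commutant_iff.1 hy a ha

theorem spanProjection_mem {S : Set H} (h : ∀ y ∈ M.commutant, ∀ v ∈ S, y v ∈ S) :
    spanProjection S ∈ M :=
  mem_of_commute fun y hy => commute_spanProjection (h y hy) (h _ (star_mem hy))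

theorem commute_spanProjection_of_mem {S : Set H} (h : ∀ y ∈ M, ∀ v ∈ S, y v ∈ S)
    {y : H →L[ℂ] H} (hy : y ∈ M) : Commute (spanProjection S) y :=
  commute_spanProjection (h y hy) (h _ (star_mem hy))

theorem _root_.IsSpectralProjection.mem {a e : H →L[ℂ] H} (h : IsSpectralProjection a e)
    (ha : a ∈ M) : e ∈ M :=
  mem_of_commute fun y hy => h.commute y (commute_of_mem ha hy)

theorem _root_.HasSum.commute {u : ℕ → H →L[ℂ] H} {a b : H →L[ℂ] H} (h : HasSum u a)
    (hu : ∀ n, Commute (u n) b) : Commute a b := by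
  have h1 := h.mul_right b
  have h2 := h.mul_left b
  simp only [fun n => (hu n).eq] at h1
  exact h1.unique h2

/-! ### Centres of corners -/

/-- A projection in the centre of a corner is the compression of a central projection. -/
theorem exists_central_of_projection {f p : H →L[ℂ] H} (hf : f ∈ M) (hp : p ∈ M)
    (hpp : IsStarProjection p) (hpf : p * f = p) (hfp : f * p = p)
    (hc : ∀ a ∈ M, Commute p (f * a * f)) :
    ∃ z ∈ M, (∀ a ∈ M, Commute z a) ∧ IsStarProjection z ∧ p = z * f := by
  -- The witness is the central support of `p`, the projection onto the closed span of `M p H`.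
  -- Invariance under `M` and its commutant makes it central in `M`.
  set S : Set H := {v | ∃ m ∈ M, ∃ w, v = m (p w)}
  have hM : ∀ y ∈ M, ∀ v ∈ S, y v ∈ S := by
    rintro y hy _ ⟨m, hm, w, rfl⟩
    exact ⟨y * m, mul_mem hy hm, w, rfl⟩
  have hM' : ∀ y ∈ M.commutant, ∀ v ∈ S, y v ∈ S := by
    rintro y hy _ ⟨m, hm, w, rfl⟩
    exact ⟨m, hm, y w, DFunLike.congr_fun (commute_of_mem (mul_mem hm hp) hy).eq.symm w⟩
  have hcz : ∀ a ∈ M, Commute (spanProjection S) a :=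
    fun a ha => commute_spanProjection_of_mem hM ha
  refine ⟨spanProjection S, spanProjection_mem hM', hcz, isStarProjection_spanProjection S, ?_⟩
  have hzp : spanProjection S * p = p := by
    ext w
    exact spanProjection_apply_of_mem ⟨1, one_mem M, w, rfl⟩
  have hpz : p * f * spanProjection S = f * spanProjection S := by
    refine eqOn_spanProjection ?_
    rintro _ ⟨m, hm, w, rfl⟩
    -- Since `p` commutes with `f * m * f`, it fixes the compression to `f` of each vector in `M p
    -- H`.
    have : p * f * m * p = f * m * p := by
      have h1 := (hc m hm).eq
      calc p * f * m * p = p * (f * m * f) * p := by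
            simp only [mul_assoc, hfp]
        _ = f * m * f * p * p := by rw [h1]
        _ = f * m * p := by simp only [mul_assoc, hpp.isIdempotentElem.eq, hfp]
    exact DFunLike.congr_fun this w
  rw [hpf, ← (hcz p hp).eq, hzp] at hpz
  rw [hpz, (hcz f hf).eq]

/-- Spectral projections of `c` lie below `f` and are central in the corner, so each lifts to a
central projection. The lifts have norm at most one, so the series with the same coefficients
converges in norm to a lift of `c`. -/
theorem exists_central_of_isSelfAdjoint {f c : H →L[ℂ] H} (hf : f ∈ M)
    (hff : IsStarProjection f) (hc : c ∈ M) (hsa : IsSelfAdjoint c) (hcf : c * f = c)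
    (hcomm : ∀ a ∈ M, Commute c (f * a * f)) :
    ∃ z ∈ M, (∀ a ∈ M, Commute z a) ∧ c = z * f := by
  obtain ⟨E, F, hE, hF, hsum⟩ := exists_hasSum_isSpectralProjection hsa
  have key : ∀ p, IsSpectralProjection c p →
      ∃ z ∈ M, (∀ a ∈ M, Commute z a) ∧ IsStarProjection z ∧ p = z * f := by
    intro p hp
    have h1 : p * f = p := by
      have := hp.mul_eq_zero (1 - f) (by rw [mul_sub, mul_one, hcf, sub_self])
      rw [mul_sub, mul_one] at this
      exact (sub_eq_zero.1 this).symm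
    have h2 : f * p = p := by
      have := congr_arg star h1
      rwa [star_mul, hff.isSelfAdjoint.star_eq, hp.1.isSelfAdjoint.star_eq] at this
    exact exists_central_of_projection hf (hp.mem hc) hp.1 h1 h2
      fun a ha => hp.commute _ (hcomm a ha)
  choose z hz hzc hzp hEz using fun n => key (E n) (hE n)
  choose w hw hwc hwp hFw using fun n => key (F n) (hF n)
  have hs : Summable fun n => (‖c‖ / 2 ^ (n + 1)) • (z n - w n) := by
    refine Summable.of_norm_bounded (g := fun n : ℕ => ‖c‖ * (1 / 2 : ℝ) ^ n)
      (summable_geometric_two.mul_left _) fun n => ?_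
    have h1 : ‖z n - w n‖ ≤ 2 := by
      have := norm_sub_le (z n) (w n)
      linarith [(hzp n).norm_le, (hwp n).norm_le]
    rw [norm_smul, Real.norm_of_nonneg (by positivity)]
    calc ‖c‖ / 2 ^ (n + 1) * ‖z n - w n‖ ≤ ‖c‖ / 2 ^ (n + 1) * 2 := by gcongr
      _ = _ := by rw [one_div, inv_pow, pow_succ]; field_simp
  refine ⟨_, mem_of_commute fun y hy => hs.hasSum.commute fun n => ?_,
    fun a ha => hs.hasSum.commute fun n => ?_, ?_⟩
  · exact ((commute_of_mem (hz n) hy).sub_left (commute_of_mem (hw n) hy)).smul_left _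
  · exact ((hzc n a ha).sub_left (hwc n a ha)).smul_left _
  · refine hsum.unique ?_
    have := hs.hasSum.mul_right f
    simpa only [smul_mul_assoc, sub_mul, ← hEz, ← hFw] using this

/-- The centre of the corner of a projection is the compression of the centre. -/
theorem exists_central_of_corner {f c : H →L[ℂ] H} (hf : f ∈ M) (hff : IsStarProjection f)
    (hc : c ∈ M) (hcf : c * f = c) (hfc : f * c = c) (hcomm : ∀ a ∈ M, Commute c (f * a * f)) :
    ∃ z ∈ M, (∀ a ∈ M, Commute z a) ∧ c = z * f := by
  have hfs := hff.isSelfAdjoint.star_eq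
  have hsf : star c * f = star c := by
    have := congr_arg star hfc
    rwa [star_mul, hfs] at this
  have hscomm : ∀ a ∈ M, Commute (star c) (f * a * f) := fun a ha => by
    have := (hcomm (star a) (star_mem ha)).star_star
    simpa only [star_mul, hfs, star_star, mul_assoc] using this
  refine of_selfAdjoint_parts (p := fun c => ∃ z ∈ M, (∀ a ∈ M, Commute z a) ∧ c = z * f)
    ?_ ?_ ?_ ?_
  · rintro _ _ ⟨z, hz, hzc, rfl⟩ ⟨w, hw, hwc, rfl⟩
    exact ⟨z + w, add_mem hz hw, fun a ha => (hzc a ha).add_left (hwc a ha), (add_mul _ _ _).symm⟩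
  · rintro k _ ⟨z, hz, hzc, rfl⟩
    exact ⟨k • z, smul_mem k hz, fun a ha => (hzc a ha).smul_left k, (smul_mul_assoc _ _ _).symm⟩
  · exact exists_central_of_isSelfAdjoint hf hff (add_mem hc (star_mem hc))
      (IsSelfAdjoint.add_star_self c) (by rw [add_mul, hcf, hsf])
      fun a ha => (hcomm a ha).add_left (hscomm a ha)
  · exact exists_central_of_isSelfAdjoint hf hff (smul_mem _ (sub_mem (star_mem hc) hc))
      (isSelfAdjoint_I_smul c) (by rw [smul_mul_assoc, sub_mul, hcf, hsf])
      fun a ha => ((hscomm a ha).sub_left (hcomm a ha)).smul_left _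

/-! ### Existence of a faithful pair -/

/-- A set of square-zero elements of `M` generating mutually annihilating ideals. -/
def IsOrthogonalNilpotentSet (M : VonNeumannAlgebra H) (S : Set (H →L[ℂ] H)) : Prop :=
  (∀ x ∈ S, x ∈ M ∧ x * x = 0) ∧ ∀ x ∈ S, ∀ y ∈ S, x ≠ y → ∀ m ∈ M, x * m * y = 0

theorem exists_maximal_isOrthogonalNilpotentSet (M : VonNeumannAlgebra H) :
    ∃ S, Maximal M.IsOrthogonalNilpotentSet S := by
  refine zorn_subset {S | M.IsOrthogonalNilpotentSet S} fun c hc hchain =>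
    ⟨⋃₀ c, ⟨?_, ?_⟩, fun s hs => Set.subset_sUnion_of_mem hs⟩
  · rintro x ⟨s, hs, hx⟩
    exact (hc hs).1 x hx
  · rintro x ⟨s, hs, hx⟩ y ⟨t, ht, hy⟩ hxy
    rcases hchain.total hs ht with h | h
    · exact (hc ht).2 x (h hx) y hy hxy
    · exact (hc hs).2 x hx y (h hy) hxy

/-- `a` annihilates from the left the ideal generated by `S`. -/
def Annihilates (M : VonNeumannAlgebra H) (S : Set (H →L[ℂ] H)) (a : H →L[ℂ] H) : Prop :=
  ∀ x ∈ S, ∀ m ∈ M, a * m * x = 0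

theorem Annihilates.mul_right {S : Set (H →L[ℂ] H)} {a b : H →L[ℂ] H} (ha : M.Annihilates S a)
    (hb : b ∈ M) : M.Annihilates S (a * b) := fun x hx m hm => by
  rw [mul_assoc a b m]; exact ha x hx _ (mul_mem hb hm)

/-- Such a `y` can be adjoined to `S`, so by maximality it already belongs to `S`; then it
annihilates its own ideal, and `y * star y * y = 0`. -/
theorem Annihilates.eq_zero_of_mul_self {S : Set (H →L[ℂ] H)}
    (hS : Maximal M.IsOrthogonalNilpotentSet S) {y : H →L[ℂ] H} (hy : M.Annihilates S y)
    (hyM : y ∈ M) (hyy : y * y = 0) : y = 0 := by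
  have hxy : ∀ x ∈ S, ∀ m ∈ M, x * m * y = 0 := fun x hx m hm => by
    apply eq_zero_of_mul_star_mul_eq_zero
    have hxM := (hS.prop.1 x hx).1
    have := hy x hx _ (mul_mem (star_mem (mul_mem (mul_mem hxM hm) hyM)) (one_mem M))
    rw [mul_one] at this
    calc x * m * y * star (x * m * y) * (x * m * y)
        = x * m * (y * star (x * m * y) * x) * m * y := by simp only [mul_assoc]
      _ = 0 := by rw [this, mul_zero, zero_mul, zero_mul]
  have hins : M.IsOrthogonalNilpotentSet (insert y S) := by
    refine ⟨?_, ?_⟩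
    · rintro x (rfl | hx)
      · exact ⟨hyM, hyy⟩
      · exact hS.prop.1 x hx
    · rintro x (rfl | hx) z (rfl | hz) hne m hm
      · exact absurd rfl hne
      · exact hy z hz m hm
      · exact hxy x hx m hm
      · exact hS.prop.2 x hx z hz hne m hm
  have hyS : y ∈ S := hS.le_of_ge hins (Set.subset_insert y S) (Set.mem_insert y S)
  exact eq_zero_of_mul_star_mul_eq_zero (hy y hyS _ (star_mem hyM))

/-- The element `e * m * (1 - e)` has square zero and annihilates the ideal of `S`, so it vanishes;
the same holds for `star m`. -/
theorem Annihilates.commute_of_isStarProjection {S : Set (H →L[ℂ] H)}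
    (hS : Maximal M.IsOrthogonalNilpotentSet S) {e : H →L[ℂ] H} (he : M.Annihilates S e)
    (heM : e ∈ M) (hep : IsStarProjection e) {m : H →L[ℂ] H} (hm : m ∈ M) : Commute e m := by
  have key : ∀ m ∈ M, e * m = e * m * e := by
    intro m hm
    have h1 : M.Annihilates S (e * (m * (1 - e))) :=
      he.mul_right (mul_mem hm (sub_mem (one_mem M) heM))
    have h2 := h1.eq_zero_of_mul_self hS (mul_mem heM (mul_mem hm (sub_mem (one_mem M) heM))) (by
      have := hep.one_sub_mul_self
      calc e * (m * (1 - e)) * (e * (m * (1 - e)))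
          = e * m * ((1 - e) * e) * (m * (1 - e)) := by simp only [mul_assoc]
        _ = 0 := by rw [this, mul_zero, zero_mul])
    rw [mul_sub, mul_one, mul_sub, ← mul_assoc] at h2
    exact sub_eq_zero.1 h2
  have h1 := key m hm
  have h2 := congr_arg star (key (star m) (star_mem hm))
  simp only [star_mul, star_star, hep.isSelfAdjoint.star_eq] at h2
  rw [commute_iff_eq, h1, h2, mul_assoc]

/-- Spectral projections of `a` kill whatever `a` kills, which reduces the claim to projections. -/
theorem Annihilates.commute_of_isSelfAdjoint {S : Set (H →L[ℂ] H)}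
    (hS : Maximal M.IsOrthogonalNilpotentSet S) {a : H →L[ℂ] H} (ha : M.Annihilates S a)
    (haM : a ∈ M) (hsa : IsSelfAdjoint a) {m : H →L[ℂ] H} (hm : m ∈ M) : Commute a m := by
  obtain ⟨E, F, hE, hF, hsum⟩ := exists_hasSum_isSpectralProjection hsa
  have key : ∀ p, IsSpectralProjection a p → Commute p m := fun p hp =>
    commute_of_isStarProjection hS (fun x hx n hn => by
      rw [mul_assoc]
      exact hp.mul_eq_zero _ (by rw [← mul_assoc]; exact ha x hx n hn)) (hp.mem haM) hp.1 hm
  exact hsum.commute fun n => ((key _ (hE n)).sub_left (key _ (hF n))).smul_left _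

/-- The complement `c` of the closed span of `M S H` is a central projection annihilating `S`, so
all of `c M` is central and `c` is abelian. Hence `c = 0`, the span is dense, and `a` vanishes on
it. -/
theorem HasNoCentralSummandTypeI₁.annihilates_eq_zero (hM : M.HasNoCentralSummandTypeI₁)
    {S : Set (H →L[ℂ] H)} (hS : Maximal M.IsOrthogonalNilpotentSet S) {a : H →L[ℂ] H}
    (ha : M.Annihilates S a) : a = 0 := by
  set T : Set H := {v | ∃ m ∈ M, ∃ x ∈ S, ∃ w, v = m (x w)}
  have hTM : ∀ y ∈ M, ∀ v ∈ T, y v ∈ T := by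
    rintro y hy _ ⟨m, hm, x, hx, w, rfl⟩
    exact ⟨y * m, mul_mem hy hm, x, hx, w, rfl⟩
  have hTM' : ∀ y ∈ M.commutant, ∀ v ∈ T, y v ∈ T := by
    rintro y hy _ ⟨m, hm, x, hx, w, rfl⟩
    exact ⟨m, hm, x, hx, y w,
      DFunLike.congr_fun (commute_of_mem (mul_mem hm (hS.prop.1 x hx).1) hy).eq.symm w⟩
  set c := 1 - spanProjection T with hc
  have hcM : c ∈ M := sub_mem (one_mem M) (spanProjection_mem hTM')
  have hcp : IsStarProjection c := (isStarProjection_spanProjection T).one_sub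
  have hcc : ∀ m ∈ M, Commute c m := fun m hm =>
    (Commute.one_left m).sub_left (commute_spanProjection_of_mem hTM hm)
  have hcS : M.Annihilates S c := fun x hx m hm => by
    rw [hc, mul_assoc, sub_mul, one_mul, sub_eq_zero]
    ext w
    exact (spanProjection_apply_of_mem (S := T) ⟨m, hm, x, hx, w, rfl⟩).symm
  have hcomm : ∀ b ∈ M, ∀ m ∈ M, Commute (c * b) m := by
    intro b hb m hm
    have hsa : ∀ d ∈ M, IsSelfAdjoint d → Commute (c * d) m := fun d hd hds =>
      (hcS.mul_right hd).commute_of_isSelfAdjoint hS (mul_mem hcM hd)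
        (by rw [isSelfAdjoint_iff, star_mul, hds.star_eq, hcp.isSelfAdjoint.star_eq,
          (hcc d hd).eq]) hm
    refine of_selfAdjoint_parts (p := fun d => Commute (c * d) m) ?_ ?_ ?_ ?_
    · intro d e hd he
      rw [mul_add]
      exact hd.add_left he
    · intro k d hd
      rw [mul_smul_comm]
      exact hd.smul_left k
    · exact hsa _ (add_mem hb (star_mem hb)) (IsSelfAdjoint.add_star_self b)
    · exact hsa _ (smul_mem _ (sub_mem (star_mem hb) hb)) (isSelfAdjoint_I_smul b)
  have hcsub : (⟨c, hcM⟩ : M) = 0 := by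
    have hpr : IsStarProjection (⟨c, hcM⟩ : M) :=
      ⟨Subtype.ext hcp.isIdempotentElem, Subtype.ext hcp.isSelfAdjoint⟩
    refine hM _ ⟨hpr, ?_⟩ ⟨hpr, fun A B => Subtype.ext ?_⟩
    · rw [Subring.mem_center_iff]
      exact fun g => Subtype.ext (hcc g g.2).eq.symm
    · have := hcomm (A * c) (mul_mem A.2 hcM) (c * B * c) (mul_mem (mul_mem hcM B.2) hcM)
      calc c * A * c * (c * B * c) = c * (A * c) * (c * B * c) := by simp only [mul_assoc]
        _ = c * B * c * (c * (A * c)) := this.eq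
        _ = c * B * c * (c * A * c) := by simp only [mul_assoc]
  have hc0 : spanProjection T = 1 := by
    have := congr_arg Subtype.val hcsub
    exact (sub_eq_zero.1 this).symm
  have : a * spanProjection T = 0 * spanProjection T := by
    refine eqOn_spanProjection ?_
    rintro _ ⟨m, hm, x, hx, w, rfl⟩
    exact DFunLike.congr_fun (ha x hx m hm) w
  rwa [hc0, zero_mul, mul_one] at this

/-- In the absence of central summands of type `I₁` there is a projection such that it and its
complement are faithful. -/
theorem HasNoCentralSummandTypeI₁.exists_projection (hM : M.HasNoCentralSummandTypeI₁) :
    ∃ p ∈ M, IsStarProjection p ∧ (∀ a ∈ M, (∀ m ∈ M, a * m * p = 0) → a = 0) ∧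
      ∀ a ∈ M, (∀ m ∈ M, a * m * (1 - p) = 0) → a = 0 := by
  obtain ⟨S, hS⟩ := M.exists_maximal_isOrthogonalNilpotentSet
  set T : Set H := {v | ∃ x ∈ S, ∃ w, v = x w}
  have hTM' : ∀ y ∈ M.commutant, ∀ v ∈ T, y v ∈ T := by
    rintro y hy _ ⟨x, hx, w, rfl⟩
    exact ⟨x, hx, y w, DFunLike.congr_fun (commute_of_mem (hS.prop.1 x hx).1 hy).eq.symm w⟩
  have hp := isStarProjection_spanProjection T
  have hpx : ∀ x ∈ S, spanProjection T * x = x := fun x hx => by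
    ext w
    exact spanProjection_apply_of_mem ⟨x, hx, w, rfl⟩
  -- Each `x` kills its own range because its square is zero, and the ranges of the other members by
  -- orthogonality.
  have hxp : ∀ x ∈ S, x * spanProjection T = 0 := fun x hx => by
    have : x * spanProjection T = 0 * spanProjection T := by
      refine eqOn_spanProjection ?_
      rintro _ ⟨y, hy, w, rfl⟩
      have hxy : x * y = 0 := by
        by_cases h : x = y
        · rw [← h]; exact (hS.prop.1 x hx).2
        · have := hS.prop.2 x hx y hy h 1 (one_mem M)
          rwa [mul_one] at this
      exact DFunLike.congr_fun hxy w
    rw [this, zero_mul]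
  refine ⟨spanProjection T, spanProjection_mem hTM', hp, fun a _ ha => ?_, fun a _ ha => ?_⟩
  · refine hM.annihilates_eq_zero hS fun x hx m hm => ?_
    rw [← hpx x hx, ← mul_assoc, ha m hm, zero_mul]
  · refine hM.annihilates_eq_zero hS fun x hx m hm => ?_
    -- Since `star x` has range under the complement, `a * m * x * star x` contains a factor `a * (m
    -- * x) * (1 - p)`, with `p` the projection; this forces `a * m * x = 0`.
    have h1 : (1 - spanProjection T) * star x = star x := by
      have := congr_arg star (hxp x hx)
      rw [star_mul, hp.isSelfAdjoint.star_eq, star_zero] at this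
      rw [sub_mul, this, one_mul, sub_zero]
    have h2 := ha (m * x) (mul_mem hm (hS.prop.1 x hx).1)
    rw [← CStarRing.mul_star_self_eq_zero_iff]
    calc a * m * x * star (a * m * x)
        = a * (m * x) * star x * star m * star a := by simp only [star_mul, mul_assoc]
      _ = a * (m * x) * (1 - spanProjection T) * star x * star m * star a := by
          rw [mul_assoc _ (1 - spanProjection T) (star x), h1]
      _ = 0 := by rw [h2, zero_mul, zero_mul, zero_mul]

theorem mem_center_of_commute {z : M} (h : ∀ a ∈ M, Commute (z : H →L[ℂ] H) a) :
    z ∈ Subring.center M :=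
  Subring.mem_center_iff.2 fun g => Subtype.ext (h g g.2).eq.symm

theorem exists_center_of_corner {p c : M} (hp : IsStarProjection (p : H →L[ℂ] H))
    (hpc : p * c = c) (hcp : c * p = c)
    (hc : ∀ a, p * a = a → a * p = a → c * a = a * c) :
    ∃ z ∈ Subring.center M, c = z * p := by
  obtain ⟨z, hz, hzc, h⟩ := exists_central_of_corner (M := M) p.2 hp c.2
    (congr_arg Subtype.val hcp) (congr_arg Subtype.val hpc) fun a ha => by
      have hpp : p * p = p := Subtype.ext hp.isIdempotentElem
      have := hc (p * ⟨a, ha⟩ * p) (by simp only [← mul_assoc, hpp])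
        (by rw [mul_assoc, hpp])
      exact congr_arg Subtype.val this
  exact ⟨⟨z, hz⟩, mem_center_of_commute hzc, Subtype.ext h⟩

theorem eq_zero_of_mul_right {p : H →L[ℂ] H} (hp : IsSelfAdjoint p)
    (h : ∀ a ∈ M, (∀ m ∈ M, a * m * p = 0) → a = 0) {a : H →L[ℂ] H} (ha : a ∈ M)
    (hpa : ∀ m ∈ M, p * m * a = 0) : a = 0 := by
  refine star_eq_zero.1 (h _ (star_mem ha) fun m hm => ?_)
  have := congr_arg star (hpa _ (star_mem hm))
  simpa only [star_mul, star_star, star_zero, hp.star_eq, mul_assoc] using this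

theorem HasNoCentralSummandTypeI₁.exists_isFaithfulPair (hM : M.HasNoCentralSummandTypeI₁) :
    ∃ e f : M, IsFaithfulPair e f := by
  obtain ⟨p, hpM, hp, h₁, h₂⟩ := hM.exists_projection
  have hq := hp.one_sub
  have hqM : 1 - p ∈ M := sub_mem (one_mem M) hpM
  refine ⟨⟨p, hpM⟩, ⟨1 - p, hqM⟩, ?_⟩
  constructor
  · exact Subtype.ext hp.isIdempotentElem
  · exact Subtype.ext (add_sub_cancel _ _)
  · exact fun a ha => Subtype.ext (h₁ a a.2 fun m hm => congr_arg Subtype.val (ha ⟨m, hm⟩))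
  · exact fun a ha => Subtype.ext (h₂ a a.2 fun m hm => congr_arg Subtype.val (ha ⟨m, hm⟩))
  · exact fun a ha => Subtype.ext (eq_zero_of_mul_right hp.isSelfAdjoint h₁ a.2
      fun m hm => congr_arg Subtype.val (ha ⟨m, hm⟩))
  · exact fun a ha => Subtype.ext (eq_zero_of_mul_right hq.isSelfAdjoint h₂ a.2
      fun m hm => congr_arg Subtype.val (ha ⟨m, hm⟩))
  · exact fun c => exists_center_of_corner hp
  · exact fun c => exists_center_of_corner hq

theorem eq_zero_of_center_of_mul_self {z : M} (hz : z ∈ Subring.center M) (h : z * z = 0) :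
    z = 0 := by
  refine Subtype.ext (eq_zero_of_mul_star_mul_eq_zero ?_)
  have h1 : z * star z * z = 0 := by
    rw [← Subring.mem_center_iff.1 hz, mul_assoc, h, mul_zero]
  exact congr_arg Subtype.val h1

end VonNeumannAlgebra

/-! ### The characterisation of Lie derivations -/

theorem corollary2p5 {H : Type*} [NormedAddCommGroup H] [InnerProductSpace ℂ H]
    [CompleteSpace H] (M : VonNeumannAlgebra H) (hM : M.HasNoCentralSummandTypeI₁)
    (L : M →+ M) :
    IsAdditiveLieDerivation L ↔
      ∃ φ f : M →+ M, IsAdditiveDerivation φ ∧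
        (∀ A : M, f A ∈ Subring.center M) ∧ (∀ A B : M, f ⁅A, B⁆ = 0) ∧
        L = φ + f := by
  constructor
  · intro hL
    obtain ⟨e, f, h⟩ := hM.exists_isFaithfulPair
    refine hL.exists_eq_add h (fun a ha => Subtype.ext ?_)
      fun z => VonNeumannAlgebra.eq_zero_of_center_of_mul_self
    have h2 : (2 : ℂ) • (a : H →L[ℂ] H) = 0 := by
      rw [two_smul]; exact congr_arg Subtype.val ha
    exact (smul_eq_zero.1 h2).resolve_left two_ne_zero
  · rintro ⟨φ, f, hφ, hf, hf0, rfl⟩ A B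
    have h1 := hf0 A B
    have h2 := hφ A B
    have h3 := hφ B A
    have h4 := Subring.mem_center_iff.1 (hf A) B
    have h5 := Subring.mem_center_iff.1 (hf B) A
    rw [AddMonoidHom.add_apply, h1]
    simp only [Ring.lie_def, AddMonoidHom.add_apply, map_sub]
    linear_combination (norm := noncomm_ring) h2 - h3 + h4 - h5
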